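/- Let $S$ be a set of $n$ points in the Euclidean plane, no three collinear and no four cocircular, and let $1\le k\le n-1$. For $i\ne j$ in $S$ let $b_{ij}$ be the perpendicular bisector of $i$ and $j$, and let $h(i,j)$ be the closed half-plane of the points at least as close to $i$ as to $j$. For a $k$-point subset $P\subseteq S$ put $f(P)=\bigcap_{i\in P,\,j\in S\setminus P}h(i,j)$. The faces of the order-$k$ Voronoi diagram $V_k(S)$ are the sets $f(P)$ with nonempty interior. The edges of a face $f(P)$ are its intersections with other faces $f(Q)$ that contain more than one point. Each edge is a (possibly unbounded) segment of a bisector $b_{ij}$ with $i,j\in S$; it carries the label $i$ on its side containing the point $i$ and the label $j$ on its side containing the point $j$. Let $f(P)$ be a face of $V_k(S)$ and let $i\in S$. Then the labels $i$ on the edges of $f(P)$ are either all on the inner side of these edges (the side of $f(P)$) or all on the outer side, and the edges of $f(P)$ carrying the label $i$ are consecutive along the boundary of $f(P)$. Here, if $f(P)$ is unbounded and the labels $i$ are on the inner side, "consecutive" refers to the cyclic order of the edges in which the boundary is closed up at infinity, that is, the two unbounded edges of $f(P)$ (if there are two) count as neighbours. In all other cases (bounded faces, and outer labels on unbounded faces),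 consecutive edges share an endpoint. -/

import Mathlib

/-- The Euclidean plane. -/
abbrev Plane : Type := EuclideanSpace ℝ (Fin 2)

namespace OrderKVoronoi

/-- General position: no three points of `S` are collinear and no four are cocircular. -/
def GeneralPosition (S : Finset Plane) : Prop :=
  (∀ T ⊆ S, T.card = 3 → ¬ Collinear ℝ (T : Set Plane)) ∧
  (∀ T ⊆ S, T.card = 4 → ¬ EuclideanGeometry.Cospherical (T : Set Plane))

/-- The perpendicular bisector `b_ij`: the points equidistant from `i` and `j`. -/
def bisector (i j : Plane) : Set Plane := {x | dist x i = dist x j}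

/-- The closed half-plane `h(i,j)`, bounded by `b_ij`, of the points at least as close to `i` as
to `j`. For `i ≠ j` it is the side of `b_ij` that contains `i`. -/
def halfPlane (i j : Plane) : Set Plane := {x | dist x i ≤ dist x j}

/-- The closed region `f(P)`: the intersection of all `h(i,j)` with `i ∈ P` and `j ∈ S \ P`, that
is, the points that have `P` as a set of `#P` nearest points of `S`. -/
def region (S P : Finset Plane) : Set Plane := ⋂ i ∈ P, ⋂ j ∈ S \ P, halfPlane i j

/-- The `k`-point subset `P` of `S` defines a face of `V_k(S)`, namely `region S P`. Not every
subset does: the region has to be two-dimensional. -/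
def DefinesFace (S : Finset Plane) (k : ℕ) (P : Finset Plane) : Prop :=
  P ⊆ S ∧ P.card = k ∧ (interior (region S P)).Nonempty

/-- `e` is an edge of the face `f(P)` of `V_k(S)`: the common boundary of `f(P)` and another face
`f(Q)`, if that is more than a single point. Edges contain their endpoints. -/
def IsEdgeOfFace (S : Finset Plane) (k : ℕ) (P : Finset Plane) (e : Set Plane) : Prop :=
  ∃ Q : Finset Plane, DefinesFace S k Q ∧ Q ≠ P ∧ e = region S P ∩ region S Q ∧ e.Nontrivial

/-- The edge `e` carries the label `i`: it lies on the bisector of `i` and another point of `S`. -/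
def HasLabel (S : Finset Plane) (e : Set Plane) (i : Plane) : Prop :=
  i ∈ S ∧ ∃ j ∈ S, j ≠ i ∧ e ⊆ bisector i j

/-- The edge `e` of `f(P)` carries the label `i` on the side of `f(P)`: the side of the edge that
contains the point `i` is the side that contains the face. -/
def HasInnerLabel (S P : Finset Plane) (e : Set Plane) (i : Plane) : Prop :=
  i ∈ S ∧ ∃ j ∈ S, j ≠ i ∧ e ⊆ bisector i j ∧ region S P ⊆ halfPlane i j

/-- The edge `e` of `f(P)` carries the label `i` on the side opposite to `f(P)`: the face lies on
the side of the edge that contains the other label `j`. -/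
def HasOuterLabel (S P : Finset Plane) (e : Set Plane) (i : Plane) : Prop :=
  i ∈ S ∧ ∃ j ∈ S, j ≠ i ∧ e ⊆ bisector i j ∧ region S P ⊆ halfPlane j i

/-- The edges of the face `f(P)` of `V_k(S)` that carry the label `i`. -/
def labelledEdges (S : Finset Plane) (k : ℕ) (P : Finset Plane) (i : Plane) : Set (Set Plane) :=
  {e | IsEdgeOfFace S k P e ∧ HasLabel S e i}

/-- Two edges of a face are neighbours on its boundary: they are distinct and share an endpoint
(distinct sides of a convex region have at most an endpoint in common). -/
def Neighbours (e e' : Set Plane) : Prop := e ≠ e' ∧ (e ∩ e').Nonempty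

/-- Neighbours in the cyclic order of the edges of a face, in which the boundary of an unbounded
face is closed up at infinity: its two unbounded edges count as neighbours as well. -/
def CyclicNeighbours (e e' : Set Plane) : Prop :=
  Neighbours e e' ∨ (e ≠ e' ∧ ¬ Bornology.IsBounded e ∧ ¬ Bornology.IsBounded e')

/-- The edges in `E` form one contiguous run with respect to the neighbour relation `adj`: one can
walk from any of them to any other through members of `E`, each a neighbour of the one before. As
the edges of a face form a path or a cycle under `adj`, this says that `E` is an interval of
consecutive edges. -/
def Consecutive (adj : Set Plane → Set Plane → Prop) (E : Set (Set Plane)) : Prop :=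
  ∀ e ∈ E, ∀ e' ∈ E, Relation.ReflTransGen (fun a b => a ∈ E ∧ b ∈ E ∧ adj a b) e e'

end OrderKVoronoi

namespace OrderKVoronoi

open Set Metric RealInnerProductSpace

/-! ### Runs of closed sets with connected union -/

section Chains

/-! Crossing an edge of `f(P)` swaps one `a ∈ P` for one `b ∈ S \ P`, so the edges are the
nontrivial sets `commonEdge S P a b` (`isEdgeOfFace_iff`). General position makes `a` and `b` the
only labels of such an edge (`eq_or_eq_of_equidistant`), so labels `i` are inner if `i ∈ P` and
outer if `i ∈ S \ P`.

Contiguity is a connectedness statement: a finite family of closed sets with connected union cannot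
split into two unlinked classes. Connectedness comes from radial projection with centre `i`. For
outer labels, a convex part of `f(P)` is contracted towards `i` onto the union of the labelled edges
(`isPreconnected_outer`). For inner labels the projection goes away from `i`, and a ray may stay in
`f(P)` forever; it is stopped at a circle of radius `M` (`exists_isPreconnected_inner`). If the
edges then form several classes, each must reach every large circle, hence has an unbounded edge,
and these edges are neighbours at infinity. -/

/-- Nontrivial members of `F` are linked if they are joined by a chain of intersecting nontrivial
members. -/
def Linked (F : Set (Set Plane)) : Set Plane → Set Plane → Prop :=
  Relation.ReflTransGen fun a b =>
    a ∈ {f ∈ F | f.Nontrivial} ∧ b ∈ {f ∈ F | f.Nontrivial} ∧ Neighbours a b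

/-- The union of the nontrivial members of `F` that are linked to `e`. -/
def linkedUnion (F : Set (Set Plane)) (e : Set Plane) : Set Plane :=
  ⋃₀ {f | f ∈ {f ∈ F | f.Nontrivial} ∧ Linked F e f}

variable {F : Set (Set Plane)} {e e' f : Set Plane}

theorem Linked.refl : Linked F e e := Relation.ReflTransGen.refl

theorem Linked.symm (h : Linked F e f) : Linked F f e := by
  induction h with
  | refl => exact Linked.refl
  | tail _ hbc ih =>
    exact Relation.ReflTransGen.head
      ⟨hbc.2.1, hbc.1, hbc.2.2.1.symm, by rw [inter_comm]; exact hbc.2.2.2⟩ ih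

theorem Linked.cyclic (h : Linked F e f) : Relation.ReflTransGen (fun a b =>
    a ∈ {f ∈ F | f.Nontrivial} ∧ b ∈ {f ∈ F | f.Nontrivial} ∧ CyclicNeighbours a b) e f :=
  Relation.ReflTransGen.mono (fun _ _ hab => ⟨hab.1, hab.2.1, Or.inl hab.2.2⟩) _ _ h

theorem isClosed_sUnion_of_finite (hF : F.Finite) (hcl : ∀ e ∈ F, IsClosed e) :
    IsClosed (⋃₀ F) := by
  rw [sUnion_eq_biUnion]
  exact hF.isClosed_biUnion hcl

theorem isClosed_linkedUnion (hF : F.Finite) (hcl : ∀ e ∈ F, IsClosed e) :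
    IsClosed (linkedUnion F e) :=
  isClosed_sUnion_of_finite (hF.subset fun _ hf => hf.1.1) fun f hf => hcl f hf.1.1

theorem disjoint_linkedUnion (hf : f ∈ {f ∈ F | f.Nontrivial}) (h : ¬ Linked F e f) :
    Disjoint (linkedUnion F e) f := by
  rw [Set.disjoint_left]
  rintro x ⟨g, ⟨hg, hrg⟩, hxg⟩ hxf
  refine h (Relation.ReflTransGen.tail hrg ⟨hg, hf, ?_, x, hxg, hxf⟩)
  rintro rfl
  exact h hrg

/-- A finite family of closed sets splits along a class of linked members: the union of that class
and the remaining members are covered by two disjoint closed sets. -/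
theorem exists_closed_separation (hF : F.Finite) (hcl : ∀ e ∈ F, IsClosed e) (e : Set Plane) :
    ∃ R : Set Plane, IsClosed R ∧ (∀ f ∈ {f ∈ F | f.Nontrivial}, ¬ Linked F e f → f ⊆ R) ∧
      Disjoint (linkedUnion F e) R ∧ ⋃₀ F ⊆ linkedUnion F e ∪ R := by
  -- A degenerate member that meets the linked class is a single point of it, so `R` needs only the
  -- members disjoint from the class.
  refine ⟨⋃₀ {f ∈ F | Disjoint (linkedUnion F e) f}, ?_, ?_, ?_, ?_⟩
  · exact isClosed_sUnion_of_finite (hF.subset (sep_subset _ _)) fun f hf => hcl f hf.1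
  · intro f hf hr
    exact subset_sUnion_of_mem (t := f) ⟨hf.1, disjoint_linkedUnion hf hr⟩
  · exact disjoint_sUnion_right.2 fun f hf => hf.2
  · rintro x ⟨f, hf, hxf⟩
    by_cases hd : Disjoint (linkedUnion F e) f
    · exact Or.inr ⟨f, ⟨hf, hd⟩, hxf⟩
    left
    obtain ⟨y, hyA, hyf⟩ := Set.not_disjoint_iff.1 hd
    by_cases hn : f.Nontrivial
    · by_contra hx
      exact hd (disjoint_linkedUnion ⟨hf, hn⟩ fun hr => hx ⟨f, ⟨⟨hf, hn⟩, hr⟩, hxf⟩)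
    · rwa [Set.not_nontrivial_iff.1 hn hxf hyf]

/-- The nontrivial members of a finite family of closed sets with connected union form one
contiguous run. -/
theorem consecutive_of_isPreconnected (hF : F.Finite) (hcl : ∀ e ∈ F, IsClosed e)
    (hB : IsPreconnected (⋃₀ F)) : Consecutive Neighbours {e ∈ F | e.Nontrivial} := by
  intro e he e' he'
  by_contra hr
  obtain ⟨R, hR, hfR, hd, hcov⟩ := exists_closed_separation hF hcl e
  obtain ⟨x, hx⟩ := he.2.nonempty
  obtain ⟨y, hy⟩ := he'.2.nonempty
  obtain ⟨z, -, hzA, hzR⟩ := isPreconnected_closed_iff.1 hB _ R (isClosed_linkedUnion hF hcl) hR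
    hcov ⟨x, ⟨e, he.1, hx⟩, ⟨e, ⟨he, .refl⟩, hx⟩⟩ ⟨y, ⟨e', he'.1, hy⟩, hfR e' he' hr hy⟩
  exact Set.disjoint_left.1 hd hzA hzR

/-- Suppose that the union of a finite family of closed sets becomes connected inside every large
ball after adding some points of the bounding sphere. Then every class of linked members that does
not exhaust the family has an unbounded member. -/
theorem exists_linked_not_isBounded (hF : F.Finite) (hcl : ∀ e ∈ F, IsClosed e) (o : Plane)
    (hB : ∀ M : ℝ, 0 < M → ∃ B : Set Plane, IsPreconnected B ∧ B ⊆ ⋃₀ F ∪ sphere o M ∧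
      ⋃₀ F ∩ closedBall o M ⊆ B)
    (he : e ∈ {e ∈ F | e.Nontrivial}) (he' : e' ∈ {e ∈ F | e.Nontrivial})
    (hr : ¬ Linked F e e') :
    ∃ u ∈ {e ∈ F | e.Nontrivial}, Linked F e u ∧ ¬ Bornology.IsBounded u := by
  by_contra! hbd
  obtain ⟨R, hR, hfR, hd, hcov⟩ := exists_closed_separation hF hcl e
  have hAb : Bornology.IsBounded (linkedUnion F e) :=
    (Bornology.isBounded_sUnion (hF.subset fun f hf => hf.1.1)).2 fun f hf => hbd f hf.1 hf.2
  obtain ⟨x, hx⟩ := he.2.nonempty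
  obtain ⟨y, hy⟩ := he'.2.nonempty
  obtain ⟨r, hAr⟩ := hAb.subset_closedBall o
  -- The circle of radius `M` lies strictly outside the bounded class and encloses `y`; added to
  -- `R`, it would still be separated from the class.
  obtain ⟨M, hM⟩ := exists_gt (max (max r (dist y o)) 0)
  obtain ⟨⟨hrM, hyM⟩, hM0⟩ := by simpa only [max_lt_iff] using hM
  obtain ⟨B, hBc, hB1, hB2⟩ := hB M hM0
  have hxA : x ∈ linkedUnion F e := ⟨e, ⟨he, .refl⟩, hx⟩
  obtain ⟨z, -, hzA, hz⟩ := isPreconnected_closed_iff.1 hBc _ (R ∪ sphere o M)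
    (isClosed_linkedUnion hF hcl) (hR.union isClosed_sphere)
    (by
      rw [← union_assoc]
      exact hB1.trans (union_subset_union_left _ hcov))
    ⟨x, hB2 ⟨⟨e, he.1, hx⟩, closedBall_subset_closedBall hrM.le (hAr hxA)⟩, hxA⟩
    ⟨y, hB2 ⟨⟨e', he'.1, hy⟩, hyM.le⟩, Or.inl (hfR e' he' hr hy)⟩
  rcases hz with hz | hz
  · exact Set.disjoint_left.1 hd hzA hz
  · exact hrM.not_ge ((mem_sphere.1 hz).ge.trans (hAr hzA))

/-- Under the same hypothesis the nontrivial members of the family form one contiguous run in the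
order closed up at infinity. -/
theorem consecutive_cyclic_of_isPreconnected (hF : F.Finite) (hcl : ∀ e ∈ F, IsClosed e)
    (o : Plane)
    (hB : ∀ M : ℝ, 0 < M → ∃ B : Set Plane, IsPreconnected B ∧ B ⊆ ⋃₀ F ∪ sphere o M ∧
      ⋃₀ F ∩ closedBall o M ⊆ B) :
    Consecutive CyclicNeighbours {e ∈ F | e.Nontrivial} := by
  intro e he e' he'
  by_cases hr : Linked F e e'
  · exact hr.cyclic
  obtain ⟨u, hu, heu, hub⟩ := exists_linked_not_isBounded hF hcl o hB he he' hr
  obtain ⟨u', hu', heu', hub'⟩ :=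
    exists_linked_not_isBounded hF hcl o hB he' he fun h => hr h.symm
  refine heu.cyclic.trans (Relation.ReflTransGen.head ⟨hu, hu', Or.inr ⟨?_, hub, hub'⟩⟩
    heu'.symm.cyclic)
  rintro rfl
  exact hr (Relation.ReflTransGen.trans heu heu'.symm)

end Chains

/-! ### Half-planes in terms of linear forms centred at a site -/

section HalfPlanes

variable {o p q x : Plane}

theorem isClosed_halfPlane (p q : Plane) : IsClosed (halfPlane p q) :=
  isClosed_le (by fun_prop) (by fun_prop)

theorem bisector_eq_inter (p q : Plane) : bisector p q = halfPlane p q ∩ halfPlane q p :=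
  Set.ext fun _ => le_antisymm_iff

theorem dist_sq_sub_dist_sq (x p q : Plane) :
    dist x q ^ 2 - dist x p ^ 2 = ‖q‖ ^ 2 - ‖p‖ ^ 2 - 2 * ⟪x, q - p⟫ := by
  rw [dist_eq_norm, dist_eq_norm, norm_sub_sq_real, norm_sub_sq_real, inner_sub_right]
  ring

theorem dist_le_dist_iff_sq : dist x p ≤ dist x q ↔ 0 ≤ dist x q ^ 2 - dist x p ^ 2 := by
  rw [sub_nonneg, sq_le_sq₀ dist_nonneg dist_nonneg]

theorem convex_halfPlane (p q : Plane) : Convex ℝ (halfPlane p q) := by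
  have : halfPlane p q = {x | ⟪x, q - p⟫ ≤ (‖q‖ ^ 2 - ‖p‖ ^ 2) / 2} := by
    ext x
    change dist x p ≤ dist x q ↔ ⟪x, q - p⟫ ≤ _
    rw [dist_le_dist_iff_sq, dist_sq_sub_dist_sq]
    constructor <;> intro h <;> linarith
  rw [this]
  exact convex_halfSpace_le
    ⟨fun a b => inner_add_left a b _, fun c a => real_inner_smul_left a _ c⟩ _

/-- The linear functional on the plane with origin `o` that has the value `1` on the bisector
of `o` and `q`. -/
noncomputable def bisectorForm (o q x : Plane) : ℝ := 2 * ⟪x - o, q - o⟫ / ‖q - o‖ ^ 2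

theorem continuous_bisectorForm (o q : Plane) : Continuous (bisectorForm o q) := by
  unfold bisectorForm
  fun_prop

theorem bisectorForm_radial (o q x : Plane) (r : ℝ) :
    bisectorForm o q (o + r • (x - o)) = r * bisectorForm o q x := by
  unfold bisectorForm
  rw [add_sub_cancel_left, real_inner_smul_left]
  ring

theorem one_sub_bisectorForm (h : q ≠ o) (x : Plane) :
    (1 - bisectorForm o q x) * ‖q - o‖ ^ 2 = dist x q ^ 2 - dist x o ^ 2 := by
  have h0 : ‖q - o‖ ^ 2 ≠ 0 := by simpa [sub_eq_zero] using h
  have hx : x - q = (x - o) - (q - o) := by abel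
  rw [bisectorForm, sub_mul, div_mul_cancel₀ (2 * ⟪x - o, q - o⟫) h0, dist_eq_norm, dist_eq_norm, hx,
    norm_sub_sq_real (x - o)]
  ring

theorem mem_halfPlane_left_iff (h : q ≠ o) : x ∈ halfPlane o q ↔ bisectorForm o q x ≤ 1 := by
  have h0 : 0 < ‖q - o‖ ^ 2 := by
    have := norm_pos_iff.2 (sub_ne_zero.2 h)
    positivity
  change dist x o ≤ dist x q ↔ _
  rw [dist_le_dist_iff_sq, ← one_sub_bisectorForm h, mul_nonneg_iff_of_pos_right h0, sub_nonneg]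

theorem mem_halfPlane_right_iff (h : q ≠ o) : x ∈ halfPlane q o ↔ 1 ≤ bisectorForm o q x := by
  have h0 : 0 < ‖q - o‖ ^ 2 := by
    have := norm_pos_iff.2 (sub_ne_zero.2 h)
    positivity
  change dist x q ≤ dist x o ↔ _
  rw [dist_le_dist_iff_sq, ← neg_sub, ← one_sub_bisectorForm h, ← neg_mul,
    mul_nonneg_iff_of_pos_right h0, neg_sub, sub_nonneg]

theorem mem_bisector_iff (h : q ≠ o) : x ∈ bisector o q ↔ bisectorForm o q x = 1 := by
  rw [bisector_eq_inter, mem_inter_iff, mem_halfPlane_left_iff h, mem_halfPlane_right_iff h,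
    le_antisymm_iff]

/-- Radial projection with centre `o` onto a level set. -/
theorem isPreconnected_radial_image {D : Set Plane} (hD : IsPreconnected D) (o : Plane)
    {g : Plane → ℝ} (hg : Continuous g) (hpos : ∀ x ∈ D, 0 < g x) :
    IsPreconnected ((fun x => o + (g x)⁻¹ • (x - o)) '' D) := by
  refine hD.image _ ?_
  have : ContinuousOn (fun x => (g x)⁻¹) D :=
    hg.continuousOn.inv₀ fun x hx => (hpos x hx).ne'
  fun_prop

end HalfPlanes

/-! ### Edges as swaps, and their labels -/

section CommonEdges

variable {S P : Finset Plane} {a b : Plane}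

/-- The points for which `a` is a farthest point of `P`, `b` is a nearest point of `S \ P`, and
which are equidistant from `a` and `b`. -/
def commonEdge (S P : Finset Plane) (a b : Plane) : Set Plane :=
  bisector a b ∩ (⋂ p ∈ P, halfPlane p a) ∩ ⋂ q ∈ S \ P, halfPlane b q

theorem mem_commonEdge {x : Plane} : x ∈ commonEdge S P a b ↔
    dist x a = dist x b ∧ (∀ p ∈ P, dist x p ≤ dist x a) ∧
      ∀ q ∈ S \ P, dist x b ≤ dist x q := by
  simp only [commonEdge, mem_inter_iff, mem_iInter, and_assoc]
  rfl

theorem mem_region {x : Plane} : x ∈ region S P ↔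
    ∀ p ∈ P, ∀ q ∈ S \ P, dist x p ≤ dist x q := by
  simp only [region, mem_iInter]
  rfl

theorem isClosed_commonEdge : IsClosed (commonEdge S P a b) := by
  rw [commonEdge, bisector_eq_inter]
  exact (((isClosed_halfPlane _ _).inter (isClosed_halfPlane _ _)).inter
    (isClosed_biInter fun _ _ => isClosed_halfPlane _ _)).inter
    (isClosed_biInter fun _ _ => isClosed_halfPlane _ _)

theorem convex_commonEdge : Convex ℝ (commonEdge S P a b) := by
  rw [commonEdge, bisector_eq_inter]
  exact (((convex_halfPlane _ _).inter (convex_halfPlane _ _)).inter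
    (convex_iInter₂ fun _ _ => convex_halfPlane _ _)).inter
    (convex_iInter₂ fun _ _ => convex_halfPlane _ _)

theorem region_inter_region_swap (haS : a ∈ S) (ha : a ∈ P) (hb : b ∈ S \ P) :
    region S P ∩ region S (insert b (P.erase a)) = commonEdge S P a b := by
  obtain ⟨hbS, hbP⟩ := Finset.mem_sdiff.1 hb
  have hab : a ≠ b := fun h => hbP (h ▸ ha)
  ext x
  rw [mem_inter_iff, mem_region, mem_region, mem_commonEdge]
  constructor
  · rintro ⟨h1, h2⟩
    have haQ : a ∈ S \ insert b (P.erase a) := by simp [haS, hab]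
    have hbQ : b ∈ insert b (P.erase a) := Finset.mem_insert_self _ _
    refine ⟨le_antisymm (h1 a ha b hb) (h2 b hbQ a haQ), fun p hp => ?_, fun q hq => ?_⟩
    · rcases eq_or_ne p a with rfl | hpa
      · exact le_rfl
      · exact h2 p (by simp [hp, hpa]) a haQ
    · rcases eq_or_ne q b with rfl | hqb
      · exact le_rfl
      · obtain ⟨hqS, hqP⟩ := Finset.mem_sdiff.1 hq
        exact h2 b hbQ q (by simp [hqS, hqP, hqb])
  · rintro ⟨h, hp, hq⟩
    refine ⟨fun p hpP q hqP => (hp p hpP).trans (h.le.trans (hq q hqP)), fun p hpQ q hqQ => ?_⟩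
    have h1 : dist x p ≤ dist x a := by
      rcases Finset.mem_insert.1 hpQ with rfl | h1
      · exact h.ge
      · exact hp p (Finset.mem_of_mem_erase h1)
    have h2 : dist x b ≤ dist x q := by
      rcases eq_or_ne q a with rfl | hqa
      · exact h.ge
      · refine hq q ?_
        simp only [Finset.mem_sdiff, Finset.mem_insert, Finset.mem_erase, not_or, not_and] at hqQ ⊢
        exact ⟨hqQ.1, hqQ.2.2 hqa⟩
    exact h1.trans (h.le.trans h2)

/-- Two distinct points are not both equidistant from three distinct points. -/
theorem not_three_equidistant {x y a b c : Plane} (hxy : x ≠ y) (hab : a ≠ b)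
    (hxa : dist x a = dist x b) (hya : dist y a = dist y b)
    (hxc : dist x c = dist x a) (hyc : dist y c = dist y a) : c = a ∨ c = b := by
  refine EuclideanGeometry.eq_of_dist_eq_of_dist_eq_of_finrank_eq_two (c₁ := x) (c₂ := y)
    (r₁ := dist x a) (r₂ := dist y a) (by simp) hxy hab ?_ ?_ ?_ ?_ ?_ ?_ <;>
  simp only [dist_comm _ x, dist_comm _ y] <;> simp [*]

/-- The two points swapped between neighbouring faces. -/
theorem exists_swap_of_nontrivial {Q : Finset Plane} (hPS : P ⊆ S) (hQS : Q ⊆ S)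
    (hcard : Q.card = P.card) (hne : Q ≠ P) (hnt : (region S P ∩ region S Q).Nontrivial) :
    ∃ a ∈ P, ∃ b ∈ S \ P, Q = insert b (P.erase a) := by
  obtain ⟨x, ⟨hxP, hxQ⟩, y, ⟨hyP, hyQ⟩, hxy⟩ := hnt
  rw [mem_region] at hxP hxQ hyP hyQ
  obtain ⟨b, hbQ, hbP⟩ := Finset.not_subset.1 fun h : Q ⊆ P =>
    hne (Finset.eq_of_subset_of_card_le h hcard.ge)
  obtain ⟨a, haP, haQ⟩ := Finset.not_subset.1 fun h : P ⊆ Q =>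
    hne (Finset.eq_of_subset_of_card_le h hcard.le).symm
  have hb : b ∈ S \ P := Finset.mem_sdiff.2 ⟨hQS hbQ, hbP⟩
  have hx : ∀ c ∈ P, c ∉ Q → dist x c = dist x b := fun c hc hcQ =>
    le_antisymm (hxP c hc b hb) (hxQ b hbQ c (Finset.mem_sdiff.2 ⟨hPS hc, hcQ⟩))
  have hy : ∀ c ∈ P, c ∉ Q → dist y c = dist y b := fun c hc hcQ =>
    le_antisymm (hyP c hc b hb) (hyQ b hbQ c (Finset.mem_sdiff.2 ⟨hPS hc, hcQ⟩))
  -- All of `P \ Q` is equidistant from `b` as seen from both `x` and `y`, and two circles with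
  -- distinct centres meet in at most two points.
  have huniq : ∀ c ∈ P, c ∉ Q → c = a := by
    intro c hc hcQ
    rcases not_three_equidistant hxy (fun h : a = b => hbP (h ▸ haP)) (hx a haP haQ)
      (hy a haP haQ) ((hx c hc hcQ).trans (hx a haP haQ).symm)
      ((hy c hc hcQ).trans (hy a haP haQ).symm) with h | rfl
    · exact h
    · exact absurd hc hbP
  refine ⟨a, haP, b, hb, (Finset.eq_of_subset_of_card_le ?_ ?_).symm⟩
  · intro p hp
    rcases Finset.mem_insert.1 hp with rfl | hp
    · exact hbQ
    · by_contra hpQ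
      exact Finset.ne_of_mem_erase hp (huniq p (Finset.mem_of_mem_erase hp) hpQ)
  · rw [Finset.card_insert_of_notMem fun h => hbP (Finset.mem_of_mem_erase h),
      Finset.card_erase_add_one haP, hcard]

/-- A nontrivial convex set is infinite, while each third site `c` spoils at most one of its points.
-/
theorem exists_mem_commonEdge_forall_ne (hab : a ≠ b) (hnt : (commonEdge S P a b).Nontrivial) :
    ∃ z ∈ commonEdge S P a b, ∀ c ∈ S, c ≠ a → c ≠ b → dist z c ≠ dist z a := by
  have hinf : (commonEdge S P a b).Infinite :=
    convex_commonEdge.isPreconnected.infinite_of_nontrivial hnt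
  have hfin : (⋃ c ∈ S, {z ∈ commonEdge S P a b | c ≠ a ∧ c ≠ b ∧ dist z c = dist z a}).Finite := by
    refine S.finite_toSet.biUnion fun c _ => Set.Subsingleton.finite ?_
    rintro x ⟨hx, hca, hcb, hxc⟩ y ⟨hy, -, -, hyc⟩
    by_contra hxy
    rcases not_three_equidistant hxy hab (mem_commonEdge.1 hx).1 (mem_commonEdge.1 hy).1 hxc hyc
      with h | h
    · exact hca h
    · exact hcb h
  obtain ⟨z, hz, hz'⟩ := (hinf.sdiff hfin).nonempty
  refine ⟨z, hz, fun c hc hca hcb h => hz' ?_⟩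
  exact mem_biUnion hc ⟨hz, hca, hcb, h⟩

theorem mem_closure_dist_lt {z : Plane} (hab : a ≠ b) (h : dist z a = dist z b) :
    z ∈ closure {x : Plane | dist x b < dist x a} := by
  have hlim : Filter.Tendsto (fun t : ℝ => z + t • (b - a)) (nhdsWithin 0 (Ioi 0)) (nhds z) := by
    have hc : Continuous fun t : ℝ => z + t • (b - a) := by fun_prop
    simpa using (hc.tendsto 0).mono_left nhdsWithin_le_nhds
  refine mem_closure_of_tendsto hlim ?_
  filter_upwards [self_mem_nhdsWithin] with t ht
  have ht : 0 < t := ht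
  change dist _ _ < dist _ _
  rw [← sq_lt_sq₀ dist_nonneg dist_nonneg, ← sub_neg, dist_sq_sub_dist_sq, inner_add_left,
    real_inner_smul_left, real_inner_self_eq_norm_sq]
  have h0 := dist_sq_sub_dist_sq z a b
  rw [h] at h0
  have h3 : 0 < ‖b - a‖ := norm_pos_iff.2 (sub_ne_zero.2 hab.symm)
  have h4 : 0 < t * ‖b - a‖ ^ 2 := by positivity
  linarith

/-- At a point of the edge whose only ties are between `a` and `b`, all other comparisons are strict
and persist nearby; moving slightly towards `b` gives an interior point of the swapped region. -/
theorem definesFace_swap {k : ℕ} (hPS : P ⊆ S) (hk : P.card = k) (ha : a ∈ P) (hb : b ∈ S \ P)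
    (hnt : (commonEdge S P a b).Nontrivial) :
    DefinesFace S k (insert b (P.erase a)) := by
  obtain ⟨hbS, hbP⟩ := Finset.mem_sdiff.1 hb
  have hab : a ≠ b := fun h => hbP (h ▸ ha)
  refine ⟨Finset.insert_subset hbS ((Finset.erase_subset _ _).trans hPS), ?_, ?_⟩
  · rw [Finset.card_insert_of_notMem fun h => hbP (Finset.mem_of_mem_erase h),
      Finset.card_erase_add_one ha, hk]
  obtain ⟨z, hz, hzne⟩ := exists_mem_commonEdge_forall_ne hab hnt
  obtain ⟨hzab, hzP, hzQ⟩ := mem_commonEdge.1 hz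
  set U : Set Plane := (⋂ p ∈ P.erase a, {x | dist x p < dist x a ∧ dist x p < dist x b}) ∩
    ⋂ q ∈ (S \ P).erase b, {x | dist x a < dist x q ∧ dist x b < dist x q} with hU
  have hlt : ∀ c d : Plane, IsOpen {x : Plane | dist x c < dist x d} := fun c d =>
    isOpen_lt (by fun_prop) (by fun_prop)
  have hUo : IsOpen U := by
    refine (isOpen_biInter_finset fun p _ => ?_).inter (isOpen_biInter_finset fun q _ => ?_)
    · exact (hlt p a).inter (hlt p b)
    · exact (hlt a q).inter (hlt b q)
  have hzU : z ∈ U := by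
    simp only [hU, mem_inter_iff, mem_iInter]
    refine ⟨fun p hp => ?_, fun q hq => ?_⟩
    · obtain ⟨hpa, hpP⟩ := Finset.mem_erase.1 hp
      have h := lt_of_le_of_ne (hzP p hpP)
        (hzne p (hPS hpP) hpa fun h => hbP (h ▸ hpP))
      exact ⟨h, hzab ▸ h⟩
    · obtain ⟨hqb, hqP⟩ := Finset.mem_erase.1 hq
      obtain ⟨hqS, hqP'⟩ := Finset.mem_sdiff.1 hqP
      have h := lt_of_le_of_ne (hzQ q hqP)
        (hzab ▸ (hzne q hqS (fun h => hqP' (h ▸ ha)) hqb).symm)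
      exact ⟨hzab.symm ▸ h, h⟩
  have hsub : U ∩ {x | dist x b < dist x a} ⊆ region S (insert b (P.erase a)) := by
    rintro x ⟨hxU, hxab⟩
    simp only [hU, mem_inter_iff, mem_iInter] at hxU
    obtain ⟨hx1, hx2⟩ := hxU
    have hxab' : dist x b < dist x a := hxab
    rw [mem_region]
    intro p hp q hq
    have h1 : dist x p ≤ dist x b := by
      rcases Finset.mem_insert.1 hp with rfl | hp
      · exact le_rfl
      · exact (hx1 p hp).2.le
    have h2 : dist x b ≤ dist x q := by
      simp only [Finset.mem_sdiff, Finset.mem_insert, Finset.mem_erase, not_or, not_and] at hq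
      rcases eq_or_ne q a with rfl | hqa
      · exact hxab'.le
      · exact (hx2 q (by simp [hq.1, hq.2.1, hq.2.2 hqa])).2.le
    exact h1.trans h2
  obtain ⟨w, hw⟩ := mem_closure_iff.1 (mem_closure_dist_lt hab hzab) U hUo hzU
  exact ⟨w, interior_maximal hsub (hUo.inter (hlt b a)) hw⟩

theorem isEdgeOfFace_iff {k : ℕ} (hPS : P ⊆ S) (hk : P.card = k) {e : Set Plane} :
    IsEdgeOfFace S k P e ↔
      ∃ a ∈ P, ∃ b ∈ S \ P, e = commonEdge S P a b ∧ e.Nontrivial := by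
  constructor
  · rintro ⟨Q, ⟨hQS, hQk, -⟩, hne, rfl, hnt⟩
    obtain ⟨a, ha, b, hb, rfl⟩ := exists_swap_of_nontrivial hPS hQS (hQk.trans hk.symm) hne hnt
    exact ⟨a, ha, b, hb, region_inter_region_swap (hPS ha) ha hb, hnt⟩
  · rintro ⟨a, ha, b, hb, rfl, hnt⟩
    refine ⟨_, definesFace_swap hPS hk ha hb hnt, ?_, (region_inter_region_swap (hPS ha) ha hb).symm, hnt⟩
    intro h
    exact (Finset.mem_sdiff.1 hb).2 (h ▸ Finset.mem_insert_self _ _)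

theorem collinear_of_inner_eq_zero {d a b c : Plane} (hd : d ≠ 0) (hb : ⟪d, b - a⟫ = 0)
    (hc : ⟪d, c - a⟫ = 0) : Collinear ℝ ({a, b, c} : Set Plane) := by
  have hd2 : d 0 ^ 2 + d 1 ^ 2 ≠ 0 := by
    intro h
    apply hd
    ext m
    fin_cases m
    · exact pow_eq_zero_iff two_ne_zero |>.1 (by change d 0 ^ 2 = 0; nlinarith [sq_nonneg (d 1)])
    · exact pow_eq_zero_iff two_ne_zero |>.1 (by change d 1 ^ 2 = 0; nlinarith [sq_nonneg (d 0)])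
  -- The vector `d` turned by a right angle spans its orthogonal complement.
  have key : ∀ u : Plane, ⟪d, u - a⟫ = 0 → ∃ r : ℝ, u = r • !₂[-d 1, d 0] +ᵥ a := by
    intro u hu
    simp only [PiLp.inner_apply, Fin.sum_univ_two, RCLike.inner_apply, conj_trivial,
      PiLp.sub_apply] at hu
    refine ⟨((u 1 - a 1) * d 0 - (u 0 - a 0) * d 1) / (d 0 ^ 2 + d 1 ^ 2), ?_⟩
    ext m
    fin_cases m
    · simp
      field_simp
      linear_combination d 0 * hu
    · simp
      field_simp
      linear_combination d 1 * hu
  rw [collinear_iff_of_mem (mem_insert a _)]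
  refine ⟨!₂[-d 1, d 0], ?_⟩
  rintro p (rfl | rfl | rfl)
  · exact ⟨0, by simp⟩
  · exact key _ hb
  · exact key _ hc

theorem dist_combination_eq (x y p q : Plane) (t : ℝ)
    (h : (1 - t) * (dist x q ^ 2 - dist x p ^ 2) + t * (dist y q ^ 2 - dist y p ^ 2) = 0) :
    dist ((1 - t) • x + t • y) p = dist ((1 - t) • x + t • y) q := by
  rw [← sq_eq_sq₀ dist_nonneg dist_nonneg, eq_comm, ← sub_eq_zero, ← h, dist_sq_sub_dist_sq,
    dist_sq_sub_dist_sq, dist_sq_sub_dist_sq, inner_add_left, real_inner_smul_left,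
    real_inner_smul_left]
  ring

/-- In general position a segment lies on at most one bisector. -/
theorem eq_or_eq_of_equidistant (hS : GeneralPosition S) {x y i j : Plane} (hxy : x ≠ y)
    (ha : a ∈ S) (hb : b ∈ S) (hi : i ∈ S) (hj : j ∈ S) (hab : a ≠ b) (hji : j ≠ i)
    (hxa : dist x a = dist x b) (hya : dist y a = dist y b)
    (hxi : dist x i = dist x j) (hyi : dist y i = dist y j) : i = a ∨ i = b := by
  by_contra! hne
  obtain ⟨hia, hib⟩ := hne
  have hja : j ≠ a := by
    rintro rfl
    rcases not_three_equidistant hxy hab hxa hya hxi hyi with h | h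
    · exact hia h
    · exact hib h
  have hjb : j ≠ b := by
    rintro rfl
    rcases not_three_equidistant hxy hab hxa hya (hxi.trans hxa.symm) (hyi.trans hya.symm)
      with h | h
    · exact hia h
    · exact hib h
  -- The difference of squared distances is affine along the line `xy`. If constant, `a`, `b`, `i`
  -- lie on one perpendicular to that line; otherwise it vanishes somewhere, at the centre of a
  -- circle through `a`, `b`, `i`, `j`.
  by_cases hconst : dist x i ^ 2 - dist x a ^ 2 = dist y i ^ 2 - dist y a ^ 2
  · have hperp : ⟪y - x, i - a⟫ = 0 := by
      rw [dist_sq_sub_dist_sq, dist_sq_sub_dist_sq] at hconst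
      rw [inner_sub_left]
      linarith
    have hperp' : ⟪y - x, b - a⟫ = 0 := by
      have h1 := dist_sq_sub_dist_sq x a b
      have h2 := dist_sq_sub_dist_sq y a b
      rw [hxa] at h1
      rw [hya] at h2
      rw [inner_sub_left]
      linarith
    refine hS.1 {a, b, i} ?_ ?_ ?_
    · simp [Finset.insert_subset_iff, ha, hb, hi]
    · exact Finset.card_eq_three.2 ⟨a, b, i, hab, hia.symm, hib.symm, rfl⟩
    · simpa using collinear_of_inner_eq_zero (sub_ne_zero.2 hxy.symm) hperp' hperp
  · obtain ⟨t, ht⟩ : ∃ t : ℝ, (1 - t) * (dist x i ^ 2 - dist x a ^ 2) +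
        t * (dist y i ^ 2 - dist y a ^ 2) = 0 := by
      have h0 := sub_ne_zero.2 hconst
      refine ⟨(dist x i ^ 2 - dist x a ^ 2) /
        (dist x i ^ 2 - dist x a ^ 2 - (dist y i ^ 2 - dist y a ^ 2)), ?_⟩
      field_simp
      ring
    refine hS.2 {a, b, i, j} ?_ ?_ ⟨(1 - t) • x + t • y, dist ((1 - t) • x + t • y) a, ?_⟩
    · simp [Finset.insert_subset_iff, ha, hb, hi, hj]
    · rw [Finset.card_insert_of_notMem (by simp [hab, hia.symm, hja.symm]),
        Finset.card_eq_three.2 ⟨b, i, j, hib.symm, hjb.symm, hji.symm, rfl⟩]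
    · have hzi : dist ((1 - t) • x + t • y) a = dist ((1 - t) • x + t • y) i :=
        dist_combination_eq x y a i t ht
      have hzb : dist ((1 - t) • x + t • y) a = dist ((1 - t) • x + t • y) b :=
        dist_combination_eq x y a b t (by rw [hxa, hya]; ring)
      have hzj : dist ((1 - t) • x + t • y) i = dist ((1 - t) • x + t • y) j :=
        dist_combination_eq x y i j t (by rw [hxi, hyi]; ring)
      simp only [Finset.coe_insert, Finset.coe_singleton, mem_insert_iff, mem_singleton_iff,
        forall_eq_or_imp, forall_eq, dist_comm _ ((1 - t) • x + t • y)]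
      exact ⟨trivial, hzb.symm, hzi.symm, (hzi.trans hzj).symm⟩

theorem labelledEdges_eq_inner (hS : GeneralPosition S) {k : ℕ} (hPS : P ⊆ S) (hk : P.card = k)
    {i : Plane} (hi : i ∈ P) :
    labelledEdges S k P i = {e ∈ (commonEdge S P i) '' (S \ P : Finset Plane) | e.Nontrivial} := by
  ext e
  simp only [labelledEdges, mem_ofPred_eq, isEdgeOfFace_iff hPS hk]
  constructor
  · rintro ⟨⟨a, ha, b, hb, rfl, hnt⟩, hiS, j, hj, hji, hsub⟩
    refine ⟨?_, hnt⟩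
    have hbS := Finset.mem_sdiff.1 hb
    have hab : a ≠ b := by rintro rfl; exact hbS.2 ha
    obtain ⟨x, hx, y, hy, hxy⟩ := hnt
    rcases eq_or_eq_of_equidistant hS hxy (hPS ha) hbS.1 hiS hj hab hji (mem_commonEdge.1 hx).1
      (mem_commonEdge.1 hy).1 (hsub hx) (hsub hy) with rfl | rfl
    · exact ⟨b, hb, rfl⟩
    · exact absurd hi hbS.2
  · rintro ⟨⟨b, hb, rfl⟩, hnt⟩
    have hb' : b ∈ S \ P := hb
    refine ⟨⟨i, hi, b, hb, rfl, hnt⟩, hPS hi, b, (Finset.mem_sdiff.1 hb').1, ?_,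
      fun x hx => (mem_commonEdge.1 hx).1⟩
    rintro rfl
    exact (Finset.mem_sdiff.1 hb').2 hi

theorem labelledEdges_eq_outer (hS : GeneralPosition S) {k : ℕ} (hPS : P ⊆ S) (hk : P.card = k)
    {i : Plane} (hi : i ∈ S \ P) :
    labelledEdges S k P i =
      {e ∈ (fun a => commonEdge S P a i) '' (P : Set Plane) | e.Nontrivial} := by
  ext e
  simp only [labelledEdges, mem_ofPred_eq, isEdgeOfFace_iff hPS hk]
  have hiS := Finset.mem_sdiff.1 hi
  constructor
  · rintro ⟨⟨a, ha, b, hb, rfl, hnt⟩, -, j, hj, hji, hsub⟩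
    refine ⟨?_, hnt⟩
    have hbS := Finset.mem_sdiff.1 hb
    have hab : a ≠ b := by rintro rfl; exact hbS.2 ha
    obtain ⟨x, hx, y, hy, hxy⟩ := hnt
    rcases eq_or_eq_of_equidistant hS hxy (hPS ha) hbS.1 hiS.1 hj hab hji (mem_commonEdge.1 hx).1
      (mem_commonEdge.1 hy).1 (hsub hx) (hsub hy) with rfl | rfl
    · exact absurd ha hiS.2
    · exact ⟨a, ha, rfl⟩
  · rintro ⟨⟨a, ha, rfl⟩, hnt⟩
    refine ⟨⟨a, ha, i, hi, rfl, hnt⟩, hiS.1, a, hPS ha, ?_,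
      fun x hx => (mem_commonEdge.1 hx).1.symm⟩
    rintro rfl
    exact hiS.2 ha

end CommonEdges

/-! ### Connectedness by radial projection from `i` -/

section Runs

variable {S P : Finset Plane} {i : Plane}

/-- The edges with outer label `i` form a connected curve. -/
theorem isPreconnected_outer (hP : P.Nonempty) (hi : i ∈ S \ P) :
    IsPreconnected (⋃₀ ((fun a => commonEdge S P a i) '' (P : Set Plane))) := by
  have hne : ∀ p ∈ P, p ≠ i := fun p hp h => (Finset.mem_sdiff.1 hi).2 (h ▸ hp)
  set g : Plane → ℝ := fun x => P.inf' hP fun p => bisectorForm i p x with hg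
  have hgc : Continuous g := Continuous.finset_inf'_apply hP fun p _ => continuous_bisectorForm i p
  set D : Set Plane := (⋂ p ∈ P, halfPlane p i) ∩ ⋂ q ∈ S \ P, halfPlane i q with hD
  have hmem : ∀ {x}, x ∈ D ↔ (∀ p ∈ P, x ∈ halfPlane p i) ∧ ∀ q ∈ S \ P, x ∈ halfPlane i q := by
    intro x
    simp only [hD, mem_inter_iff, mem_iInter]
  have hDc : Convex ℝ D := (convex_iInter₂ fun _ _ => convex_halfPlane _ _).inter
    (convex_iInter₂ fun _ _ => convex_halfPlane _ _)
  have hg1 : ∀ x ∈ D, 1 ≤ g x := fun x hx => Finset.le_inf' _ _ fun p hp =>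
    (mem_halfPlane_right_iff (hne p hp)).1 ((hmem.1 hx).1 p hp)
  convert isPreconnected_radial_image hDc.isPreconnected i hgc
    fun x hx => one_pos.trans_le (hg1 x hx)
  ext y
  constructor
  · rintro ⟨_, ⟨a, ha, rfl⟩, hy⟩
    obtain ⟨hya, hyP, hyQ⟩ := mem_commonEdge.1 hy
    have hyD : y ∈ D := hmem.2 ⟨fun p hp => (hyP p hp).trans hya.le, hyQ⟩
    have hgy : g y = 1 := le_antisymm ((Finset.inf'_le _ ha).trans_eq
      ((mem_bisector_iff (hne a ha)).1 hya.symm)) (hg1 y hyD)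
    exact ⟨y, hyD, by simp [hgy]⟩
  · rintro ⟨x, hx, rfl⟩
    have hgx := hg1 x hx
    have hr0 : 0 < (g x)⁻¹ := by positivity
    have hr1 : (g x)⁻¹ ≤ 1 := inv_le_one_of_one_le₀ hgx
    obtain ⟨a, ha, hga⟩ := P.exists_mem_eq_inf' hP fun p => bisectorForm i p x
    have hgx0 : g x ≠ 0 := by positivity
    have hxa : bisectorForm i a (i + (g x)⁻¹ • (x - i)) = 1 := by
      rw [bisectorForm_radial, ← show g x = bisectorForm i a x from hga, inv_mul_cancel₀ hgx0]
    have hya := (mem_bisector_iff (hne a ha)).2 hxa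
    refine ⟨_, ⟨a, ha, rfl⟩, mem_commonEdge.2 ⟨hya.symm, fun p hp => ?_, fun q hq => ?_⟩⟩
    · refine le_trans ?_ (le_of_eq hya)
      refine (mem_halfPlane_right_iff (hne p hp)).2 ?_
      rw [bisectorForm_radial, ← inv_mul_cancel₀ hgx0]
      exact mul_le_mul_of_nonneg_left (Finset.inf'_le _ hp) hr0.le
    · rcases eq_or_ne q i with rfl | hqi
      · exact le_rfl
      · refine (mem_halfPlane_left_iff hqi).2 ?_
        have hq1 := (mem_halfPlane_left_iff hqi).1 ((hmem.1 hx).2 q hq)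
        rw [bisectorForm_radial]
        -- Contracting towards `i` keeps `i` nearest in `S \ P`.
        exact (mul_le_of_le_one_right hr0.le hq1).trans hr1

/-- The edges with inner label `i`, cut off by a circle with centre `i`, are completed to a
connected curve by arcs of that circle. -/
theorem exists_isPreconnected_inner (hne : (S \ P).Nonempty) (hi : i ∈ P) {M : ℝ} (hM : 0 < M) :
    ∃ B : Set Plane, IsPreconnected B ∧
      B ⊆ ⋃₀ ((commonEdge S P i) '' (S \ P : Finset Plane)) ∪ sphere i M ∧
      ⋃₀ ((commonEdge S P i) '' (S \ P : Finset Plane)) ∩ closedBall i M ⊆ B := by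
  have hqi : ∀ q ∈ S \ P, q ≠ i := fun q hq h => (Finset.mem_sdiff.1 hq).2 (h ▸ hi)
  set g : Plane → ℝ := fun x => (S \ P).sup' hne fun q => bisectorForm i q x with hg
  -- The gauge of the Voronoi cell of `i` among `i` and `S \ P`, truncated to the ball of radius
  -- `M`; the second term also makes it positive away from `i`.
  set h : Plane → ℝ := fun x => max (g x) (dist x i / M) with hh
  have hhc : Continuous h := by
    have hgc : Continuous g :=
      Continuous.finset_sup'_apply hne fun q _ => continuous_bisectorForm i q
    fun_prop
  have hpos : ∀ x ≠ i, 0 < h x := fun x hx => lt_max_of_lt_right (div_pos (dist_pos.2 hx) hM)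
  have hrad : ∀ x, ∀ r : ℝ, 0 ≤ r → h (i + r • (x - i)) = r * h x := by
    intro x r hr
    have h1 : g (i + r • (x - i)) = r * g x := by
      simp only [hg, bisectorForm_radial]
      exact (Finset.mul₀_sup' hr _ _ hne).symm
    have h2 : dist (i + r • (x - i)) i = r * dist x i := by
      rw [dist_eq_norm, add_sub_cancel_left, norm_smul, Real.norm_of_nonneg hr, dist_eq_norm]
    simp only [hh]
    rw [h1, h2, mul_max_of_nonneg _ _ hr, mul_div_assoc]
  have hle : ∀ x, h x ≤ 1 ↔ (∀ q ∈ S \ P, x ∈ halfPlane i q) ∧ x ∈ closedBall i M := by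
    intro x
    rw [hh, max_le_iff, div_le_one hM, mem_closedBall, Finset.sup'_le_iff]
    exact and_congr_left' (forall₂_congr fun q hq => (mem_halfPlane_left_iff (hqi q hq)).symm)
  set B : Set Plane := {x | (∀ p ∈ P, x ∈ halfPlane p i) ∧ h x = 1} with hB
  refine ⟨B, ?_, ?_, ?_⟩
  · obtain ⟨D, hDc, hDi, hBD, hDB⟩ : ∃ D : Set Plane, IsPreconnected D ∧ (∀ x ∈ D, x ≠ i) ∧
        B ⊆ D ∧ ∀ x ∈ D, ∀ p ∈ P, i + (h x)⁻¹ • (x - i) ∈ halfPlane p i := by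
      -- If `P = {i}`, the face surrounds `i` and all directions occur, so the punctured plane is
      -- projected. Otherwise `i` is not its own farthest point in `P`, and a convex set avoiding
      -- `i` serves.
      by_cases hP : ∀ p ∈ P, p = i
      · refine ⟨{i}ᶜ, ?_, fun x hx => hx, ?_, ?_⟩
        · refine (isConnected_compl_singleton_of_one_lt_rank ?_ i).isPreconnected
          rw [← Module.finrank_eq_rank]
          simp
        · rintro x ⟨-, hx1⟩ rfl
          have := hrad x 0 le_rfl
          simp [hx1] at this
        · rintro x - p hp
          rw [hP p hp]
          exact le_rfl (a := dist _ _)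
      · push Not at hP
        obtain ⟨p₀, hp₀, hp₀i⟩ := hP
        refine ⟨(⋂ p ∈ P, halfPlane p i) ∩ ((⋂ q ∈ S \ P, halfPlane i q) ∩ closedBall i M),
          ?_, ?_, ?_, ?_⟩
        · exact ((convex_iInter₂ fun _ _ => convex_halfPlane _ _).inter
            ((convex_iInter₂ fun _ _ => convex_halfPlane _ _).inter
              (convex_closedBall _ _))).isPreconnected
        · rintro x ⟨hx, -⟩ rfl
          have : dist x p₀ ≤ dist x x := mem_iInter₂.1 hx p₀ hp₀
          rw [dist_self] at this
          exact hp₀i (dist_le_zero.1 this).symm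
        · rintro x ⟨hx, hx1⟩
          obtain ⟨h1, h2⟩ := (hle x).1 hx1.le
          exact ⟨mem_iInter₂.2 hx, mem_iInter₂.2 h1, h2⟩
        · rintro x ⟨hx, hxV, hxM⟩ p hp
          rcases eq_or_ne p i with rfl | hpi
          · exact le_rfl (a := dist _ _)
          have hx1 : h x ≤ 1 := (hle x).2 ⟨mem_iInter₂.1 hxV, hxM⟩
          have hxp := (mem_halfPlane_right_iff hpi).1 (mem_iInter₂.1 hx p hp)
          have hxi : x ≠ i := by
            rintro rfl
            simp [bisectorForm] at hxp
            norm_num at hxp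
          rw [mem_halfPlane_right_iff hpi, bisectorForm_radial]
          -- Since `h x ≤ 1`, the point moves away from `i`, which keeps `i` farthest in `P`.
          exact one_le_mul_of_one_le_of_one_le ((one_le_inv₀ (hpos x hxi)).2 hx1) hxp
    convert isPreconnected_radial_image hDc i hhc fun x hx => hpos x (hDi x hx)
    ext y
    constructor
    · intro hy
      exact ⟨y, hBD hy, by simp [hy.2]⟩
    · rintro ⟨x, hx, rfl⟩
      have hx0 := hpos x (hDi x hx)
      exact ⟨hDB x hx, by rw [hrad _ _ (by positivity), inv_mul_cancel₀ hx0.ne']⟩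
  · rintro y ⟨hyP, hy1⟩
    obtain ⟨hyQ, -⟩ := (hle y).1 hy1.le
    rcases max_choice (g y) (dist y i / M) with hm | hm
    · left
      obtain ⟨q, hq, hgq⟩ := (S \ P).exists_mem_eq_sup' hne fun q => bisectorForm i q y
      refine ⟨_, ⟨q, hq, rfl⟩, mem_commonEdge.2 ⟨?_, hyP, ?_⟩⟩
      · exact (mem_bisector_iff (hqi q hq)).2 (hgq.symm.trans (hm.symm.trans hy1))
      · intro q' hq'
        have : y ∈ bisector i q :=
          (mem_bisector_iff (hqi q hq)).2 (hgq.symm.trans (hm.symm.trans hy1))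
        exact (le_of_eq this.symm).trans (hyQ q' hq')
    · right
      rw [mem_sphere, ← div_eq_one_iff_eq hM.ne']
      exact hm.symm.trans hy1
  · rintro y ⟨⟨_, ⟨q, hq, rfl⟩, hy⟩, hyM⟩
    have hq : q ∈ S \ P := hq
    obtain ⟨hyq, hyP, hyQ⟩ := mem_commonEdge.1 hy
    refine ⟨hyP, le_antisymm ((hle y).2 ⟨fun q' hq' => hyq.le.trans (hyQ q' hq'), hyM⟩) ?_⟩
    exact le_max_of_le_left (((mem_bisector_iff (hqi q hq)).1 hyq).ge.trans
      (Finset.le_sup' (fun q => bisectorForm i q y) hq))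

end Runs

end OrderKVoronoi

/-! ### The theorem -/

open OrderKVoronoi in
theorem mainTheorem2 (S : Finset Plane) (hS : OrderKVoronoi.GeneralPosition S)
    (k : ℕ) (hk : 1 ≤ k) (hkn : k + 1 ≤ S.card)
    (P : Finset Plane) (hP : OrderKVoronoi.DefinesFace S k P) (i : Plane) :
    ((∀ e ∈ OrderKVoronoi.labelledEdges S k P i, OrderKVoronoi.HasInnerLabel S P e i) ∧
        OrderKVoronoi.Consecutive OrderKVoronoi.CyclicNeighbours
          (OrderKVoronoi.labelledEdges S k P i)) ∨
      ((∀ e ∈ OrderKVoronoi.labelledEdges S k P i, OrderKVoronoi.HasOuterLabel S P e i) ∧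
        OrderKVoronoi.Consecutive OrderKVoronoi.Neighbours
          (OrderKVoronoi.labelledEdges S k P i)) := by
  obtain ⟨hPS, hPk, -⟩ := hP
  by_cases hiS : i ∈ S
  swap
  · have h0 : labelledEdges S k P i = ∅ :=
      Set.eq_empty_of_forall_notMem fun e he => hiS he.2.1
    left
    rw [h0]
    exact ⟨fun _ h => h.elim, fun _ h => h.elim⟩
  by_cases hi : i ∈ P
  · left
    have hne : (S \ P).Nonempty := by
      rw [← Finset.card_pos, Finset.card_sdiff_of_subset hPS]
      omega
    rw [labelledEdges_eq_inner hS hPS hPk hi]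
    refine ⟨?_, consecutive_cyclic_of_isPreconnected ((Finset.finite_toSet _).image _) ?_ i
      fun M hM => exists_isPreconnected_inner hne hi hM⟩
    · rintro e ⟨⟨b, hb, rfl⟩, -⟩
      have hb' := Finset.mem_sdiff.1 (Finset.mem_coe.1 hb)
      exact ⟨hiS, b, hb'.1, fun h => hb'.2 (h ▸ hi), fun x hx => (mem_commonEdge.1 hx).1,
        fun x hx => mem_region.1 hx i hi b hb⟩
    · rintro e ⟨b, -, rfl⟩
      exact isClosed_commonEdge
  · right
    have hi' : i ∈ S \ P := Finset.mem_sdiff.2 ⟨hiS, hi⟩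
    rw [labelledEdges_eq_outer hS hPS hPk hi']
    refine ⟨?_, consecutive_of_isPreconnected ((Finset.finite_toSet _).image _) ?_
      (isPreconnected_outer (Finset.card_pos.1 (by omega)) hi')⟩
    · rintro e ⟨⟨a, ha, rfl⟩, -⟩
      exact ⟨hiS, a, hPS ha, fun h => hi (h ▸ ha), fun x hx => (mem_commonEdge.1 hx).1.symm,
        fun x hx => mem_region.1 hx a ha i hi'⟩
    · rintro e ⟨a, -, rfl⟩
      exact isClosed_commonEdge
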